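/- A \emph{probabilistic counter machine} (pCM) consists of a finite set $Q$ of control states, a finite number $d$ of counters, a finite set $\Delta=\Delta_0\uplus\Delta_1$ of transitions with $\Delta_0\subseteq Q\times\{1,\dots,d\}\times\mathbb N^d\times Q$ and $\Delta_1\subseteq Q\times\mathbb N^d\times\mathbb N^d\times Q$, and a computable weight function $W:\Delta\times\mathbb N^d\to\mathbb N_{>0}$. It is \emph{static} if for every $t\in\Delta$ the function $W(t,\cdot)$ is constant. A transition $(q,c,\mathrm{Post},q')\in\Delta_0$ is enabled in a configuration $(q,m)\in Q\times\mathbb N^d$ if $m(c)=0$, and leads to $(q',m+\mathrm{Post})$; a transition $(q,\mathrm{Pre},\mathrm{Post},q')\in\Delta_1$ is enabled in $(q,m)$ if $m\ge\mathrm{Pre}$, and leads to $(q',m-\mathrm{Pre}+\mathrm{Post})$. In the Markov chain of the pCM, on the state space $Q\times\mathbb N^d$, a configuration $s=(q,m)$ with enabled transitions moves to $s'$ with probability equal to the sum of the weights $W(t,m)$ of the enabled $t$ leading from $s$ to $s'$, divided by the sum of the weights $W(t,m)$ of all enabled $t$; a configuration without enabled transition stays where it is with probability $1$. The chain is \emph{decisive}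 with respect to a configuration $s_0$ and a set $A$ of configurations if, started in $s_0$, with probability $0$ it visits for ever only configurations that are outside $A$ and from which $A$ is reachable. \textbf{Theorem.} The following problem is undecidable: given a static pCM, a configuration $s_0$ and a finite set $A$ of configurations, is its Markov chain decisive with respect to $s_0$ and $A$? A fortiori the same problem is undecidable for general pCMs, whose weight functions are given by programs that compute them. That is, in neither case is there a total computable function that answers correctly on every (finite description of a) valid input. -/

import Mathlib

open MeasureTheory ProbabilityTheory
open scoped NNReal ENNReal

/-! ### Markov chains and decisiveness -/

/-- A Markov chain on a (countable) state space `S`: every state carries a rational distribution. -/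
structure MarkovChain (S : Type) where
  /-- the transition probabilities -/
  p : S → S → ℚ≥0
  hasSum_p : ∀ s, HasSum (fun s' => (p s s' : ℝ≥0)) 1

namespace MarkovChain

variable {S : Type} (M : MarkovChain S)

/-- `s → s'` when `p(s, s') > 0`. -/
def Step (s s' : S) : Prop := 0 < M.p s s'

/-- The set `A` is reachable from `s`, i.e. `s` satisfies `EF A`. -/
def CanReach (s : S) (A : Set S) : Prop := ∃ s' ∈ A, Relation.ReflTransGen M.Step s s'

/-- The distribution `p(s)` as a probability mass function. -/
noncomputable def pmf (s : S) : PMF S :=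
  ⟨fun s' => ((M.p s s' : ℝ≥0) : ℝ≥0∞), ENNReal.hasSum_coe.2 (M.hasSum_p s)⟩

variable [Countable S] [MeasurableSpace S] [DiscreteMeasurableSpace S]

/-- The law of the `(n+1)`-st state given the states `0, …, n`: it is `p` of the `n`-th state. -/
noncomputable def stepKernel (n : ℕ) : Kernel ((_ : Finset.Iic n) → S) S where
  toFun x := (M.pmf (x ⟨n, Finset.mem_Iic.2 le_rfl⟩)).toMeasure
  measurable' :=
    (Measurable.of_discrete (f := fun s => (M.pmf s).toMeasure)).comp
      (measurable_pi_apply _)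

instance (n : ℕ) : IsMarkovKernel (M.stepKernel n) :=
  ⟨fun _ => PMF.toMeasure.isProbabilityMeasure _⟩

/-- `Pr_{M, s₀}`, the probability on infinite sequences of states, started in `s₀`. -/
noncomputable def pathMeasure (s₀ : S) : Measure (ℕ → S) :=
  Kernel.traj (X := fun _ => S) M.stepKernel 0 (fun _ => s₀)

/-- `M` is decisive w.r.t. `s₀` and `A` when `Pr_{M, s₀}(G (Aᶜ ∩ EF A)) = 0`. -/
def IsDecisive (s₀ : S) (A : Set S) : Prop :=
  M.pathMeasure s₀ {σ | ∀ i, σ i ∉ A ∧ M.CanReach (σ i) A} = 0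

end MarkovChain

/-! ### Probabilistic counter machines -/

/-- Transitions of a machine with `n` control states and `d` counters: `zero q⁻ c Post q⁺` is a
zero-test of counter `c`, and `pre q⁻ Pre Post q⁺` is an ordinary transition. -/
inductive Transition (n d : ℕ) : Type
  | zero : Fin n → Fin d → (Fin d → ℕ) → Fin n → Transition n d
  | pre : Fin n → (Fin d → ℕ) → (Fin d → ℕ) → Fin n → Transition n d

/-- Configurations: a control state together with the values of the counters. -/
abbrev Config (n d : ℕ) : Type := Fin n × (Fin d → ℕ)

namespace Transition

variable {n d : ℕ}

/-- The transition can be fired in the configuration. -/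
def Enabled : Transition n d → Config n d → Prop
  | zero q c _ _, s => s.1 = q ∧ s.2 c = 0
  | pre q Pre _ _, s => s.1 = q ∧ Pre ≤ s.2

/-- The configuration reached by firing the transition (used only where it is enabled). -/
def fire : Transition n d → Config n d → Config n d
  | zero _ _ Post q', s => (q', s.2 + Post)
  | pre _ Pre Post q', s => (q', s.2 - Pre + Post)

end Transition

/-- A probabilistic counter machine with control states `Fin n` and counters `Fin d`.
`Δ` is the disjoint union of the zero-tests and of the ordinary transitions; only the values
`W t` for `t ∈ Δ` are meaningful. As `Δ` is finite, `W` is computable on `Δ × ℕ^d` exactly when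
each `W t` is. -/
structure PCM (n d : ℕ) where
  Δ : Finset (Transition n d)
  W : Transition n d → (Fin d → ℕ) → ℕ
  W_pos : ∀ t ∈ Δ, ∀ m, 0 < W t m
  W_computable : ∀ t ∈ Δ, Computable (W t)

namespace PCM

variable {n d : ℕ} (C : PCM n d)

/-- All weights are constant. -/
def IsStatic : Prop := ∀ t ∈ C.Δ, ∃ w, ∀ m, C.W t m = w

open Classical in
/-- The set of enabled transitions. -/
noncomputable def En (s : Config n d) : Finset (Transition n d) := {t ∈ C.Δ | t.Enabled s}

/-- The total weight of the enabled transitions. -/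
noncomputable def weight (s : Config n d) : ℕ := ∑ t ∈ C.En s, C.W t s.2

open Classical in
/-- The transition probabilities between configurations. -/
noncomputable def prob (s s' : Config n d) : ℚ≥0 :=
  if C.En s = ∅ then (if s' = s then 1 else 0)
  else (C.weight s : ℚ≥0)⁻¹ * ∑ t ∈ C.En s with t.fire s = s', (C.W t s.2 : ℚ≥0)

theorem hasSum_prob (s : Config n d) : HasSum (fun s' => (C.prob s s' : ℝ≥0)) 1 := by
  classical
  by_cases h : C.En s = ∅
  · have : (fun s' => (C.prob s s' : ℝ≥0)) = fun s' => if s' = s then 1 else 0 := by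
      funext s'
      by_cases hs : s' = s <;> simp [prob, h, hs]
    rw [this]
    exact hasSum_ite_eq s 1
  · have hw : C.weight s ≠ 0 := by
      obtain ⟨t, ht⟩ := Finset.nonempty_iff_ne_empty.2 h
      have h1 : 0 < C.W t s.2 := C.W_pos t (Finset.mem_filter.1 ht).1 s.2
      have h2 : C.W t s.2 ≤ C.weight s :=
        Finset.single_le_sum (f := fun t => C.W t s.2) (fun _ _ => Nat.zero_le _) ht
      omega
    have hp : ∀ s', C.prob s s' = (C.weight s : ℚ≥0)⁻¹ *
        ∑ t ∈ C.En s with t.fire s = s', (C.W t s.2 : ℚ≥0) := by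
      intro s'
      rw [prob, if_neg h]
    have hz : ∀ s' ∉ (C.En s).image (fun t => t.fire s), (C.prob s s' : ℝ≥0) = 0 := by
      intro s' hs'
      rw [hp, Finset.sum_eq_zero, mul_zero, NNRat.cast_zero]
      intro t ht
      rw [Finset.mem_filter] at ht
      exact absurd (Finset.mem_image.2 ⟨t, ht.1, ht.2⟩) hs'
    have hsum : ∑ s' ∈ (C.En s).image (fun t => t.fire s), C.prob s s' = 1 := by
      simp_rw [hp]
      rw [← Finset.mul_sum,
        Finset.sum_fiberwise_of_maps_to (fun t ht => Finset.mem_image_of_mem _ ht)]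
      rw [← Nat.cast_sum]
      exact inv_mul_cancel₀ (Nat.cast_ne_zero.2 hw)
    have h1 : ∑ s' ∈ (C.En s).image (fun t => t.fire s), (C.prob s s' : ℝ≥0) = 1 := by
      rw [← NNRat.cast_sum, hsum, NNRat.cast_one]
    rw [← h1]
    exact hasSum_sum_of_ne_finset_zero hz

/-- The Markov chain of a probabilistic counter machine. -/
noncomputable def chain : MarkovChain (Config n d) where
  p := C.prob
  hasSum_p := C.hasSum_prob

end PCM

/-! ### Finite descriptions of the inputs -/

/-- Description of a configuration: the control state and the list of counter values. -/
abbrev ConfigCode : Type := ℕ × List ℕ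

/-- Description of a transition: `(q⁻, c, Post, q⁺)` or `(q⁻, Pre, Post, q⁺)`. -/
abbrev TransitionCode : Type := (ℕ × ℕ × List ℕ × ℕ) ⊕ (ℕ × List ℕ × List ℕ × ℕ)

/-- Description of an input: number of control states, number of counters, list of the transitions
with descriptions (of type `ω`) of their weights, initial configuration, list of the targets. -/
abbrev InputCode (ω : Type) : Type :=
  ℕ × ℕ × List (TransitionCode × ω) × ConfigCode × List ConfigCode

def Config.code {n d : ℕ} (s : Config n d) : ConfigCode := (s.1.val, List.ofFn s.2)

def Transition.code {n d : ℕ} : Transition n d → TransitionCode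
  | .zero q c Post q' => .inl (q.val, c.val, List.ofFn Post, q'.val)
  | .pre q Pre Post q' => .inr (q.val, List.ofFn Pre, List.ofFn Post, q'.val)

/-- `c` describes the machine `C`, the initial configuration `s₀` and the finite target `A`, where
`R x f` says that `x` describes the weight function `f`. -/
def Describes {ω : Type} {n d : ℕ} (R : ω → ((Fin d → ℕ) → ℕ) → Prop) (c : InputCode ω)
    (C : PCM n d) (s₀ : Config n d) (A : Finset (Config n d)) : Prop :=
  ∃ (l : List (Transition n d × ω)) (a : List (Config n d)),
    (∀ t, t ∈ C.Δ ↔ ∃ x, (t, x) ∈ l) ∧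
    (∀ t x, (t, x) ∈ l → R x (C.W t)) ∧
    (∀ s, s ∈ A ↔ s ∈ a) ∧
    c = (n, d, l.map (fun tx => (tx.1.code, tx.2)), Config.code s₀, a.map Config.code)

/-- The number `w` describes the constant weight `w`. -/
def ConstWeight {d : ℕ} (w : ℕ) (f : (Fin d → ℕ) → ℕ) : Prop := ∀ m, f m = w

/-- The program `e` computes the weight `f`. -/
def ProgramWeight {d : ℕ} (e : Nat.Partrec.Code) (f : (Fin d → ℕ) → ℕ) : Prop :=
  ∀ m, e.eval (Encodable.encode (List.ofFn m)) = Part.some (f m)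

/-!
The halting problem is reduced to non-decisiveness. A single machine serves for all instances: the
instance is the initial value of one counter.

*Computation.* The halting of the program coded by `x` is a statement `∃ k, f k x = 0` with `f`
primitive recursive. Regular expressions over the operations increment, decrement and zero test
denote relations on counter values (`CounterProg`); loops `while i ≠ 0` are such expressions, and by
induction over `Nat.Primrec'` every primitive recursive function is computed by one
(`StackComputable.of_primrec`). Guessing `k` nondeterministically, computing `f k x` and testing it
for zero gives an expression that relates the initial counter values `(x, 0, 0, …)` to something
exactly if the program halts, and then only to `0` (`exists_counterProg_of_primrec`). A finite
automaton for this expression (`CounterProg.exists_graph`) is the control graph of a machine.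

*Random walk.* From the exit of the graph the machine enters a random walk on one counter, going up
with weight `2` and down with weight `1`, which at height zero may stop in a dead end, the only
target (`walkPCM`). If the exit is not reachable, neither is the target, and the chain is decisive
for trivial reasons. If it is reachable, then with positive probability the walk is entered; from
height `1` the walk returns to zero with probability only `1/2`, while the target stays reachable,
so the chain is not decisive (`isDecisive_walkPCM_iff`). The nondeterminism of the guess does no
harm: reaching the walk with positive probability is enough.

*Probability.* Non-decisiveness is established by a superharmonic function `h` that is `1` wherever
the event `G (Aᶜ ∩ EF A)` fails and less than `1` at the initial state: frozen at the first failure,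
`h` along the path is a supermartingale, so the event fails with probability at most `h s₀ < 1`
(`MarkovChain.not_isDecisive_of_isCertificate`). For the walk, `h = 2⁻ᶜ` at height `c`; certificates
are pulled back along paths by averaging (`MarkovChain.IsCertificate.of_step`).
-/

/-! ### Superharmonic certificates against decisiveness -/

namespace MarkovChain

variable {S : Type} (M : MarkovChain S)

/-- The states at which the event `G (Aᶜ ∩ EF A)` is violated: those in `A` and those from
which `A` cannot be reached. -/
def lost (A : Set S) : Set S := {s | s ∈ A ∨ ¬ M.CanReach s A}

/-- The expected value of `h` after one step from `s`. -/
noncomputable def expect (h : S → ℝ≥0∞) (s : S) : ℝ≥0∞ :=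
  ∑' s', ((M.p s s' : ℝ≥0) : ℝ≥0∞) * h s'

/-- A function witnessing that `s` leaves `G (Aᶜ ∩ EF A)` with probability less than `1`: it is
superharmonic outside the lost states, equal to `1` at the lost states, and below `1` at `s`. -/
structure IsCertificate (A : Set S) (s : S) (h : S → ℝ≥0∞) : Prop where
  expect_le : ∀ t ∉ M.lost A, M.expect h t ≤ h t
  eq_one : ∀ t ∈ M.lost A, h t = 1
  le_one : ∀ t, h t ≤ 1
  lt_one : h s < 1

variable {M}

theorem tsum_p (s : S) : ∑' s', ((M.p s s' : ℝ≥0) : ℝ≥0∞) = 1 :=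
  (ENNReal.hasSum_coe.2 (M.hasSum_p s)).tsum_eq

theorem expect_mono {h k : S → ℝ≥0∞} (hk : ∀ s, h s ≤ k s) (s : S) :
    M.expect h s ≤ M.expect k s :=
  ENNReal.tsum_le_tsum fun s' => by gcongr; exact hk s'

theorem expect_le_one {h : S → ℝ≥0∞} (h1 : ∀ s, h s ≤ 1) (s : S) : M.expect h s ≤ 1 := by
  refine (expect_mono (k := fun _ => 1) h1 s).trans ?_
  simp [expect, tsum_p]

theorem expect_lt_one {h : S → ℝ≥0∞} (h1 : ∀ s, h s ≤ 1) {s s' : S} (hs : M.Step s s')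
    (h' : h s' < 1) : M.expect h s < 1 := by
  rw [← tsum_p (M := M) s]
  have hne : M.expect h s ≠ ∞ := ((expect_le_one h1 s).trans_lt ENNReal.one_lt_top).ne
  refine ENNReal.tsum_lt_tsum (i := s') hne (fun t => mul_le_of_le_one_right' (h1 t)) ?_
  have hp : ((M.p s s' : ℝ≥0) : ℝ≥0∞) ≠ 0 := by
    have : 0 < M.p s s' := hs
    simpa using this.ne'
  simpa using ENNReal.mul_lt_mul_right hp ENNReal.coe_ne_top h'

/-- A certificate for `s'` yields one for each predecessor `s` of `s'`: replace `h` by its one-step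
average outside the lost states. -/
theorem IsCertificate.of_step {A : Set S} (hA : ∀ s ∈ A, ∀ s', M.Step s s' → s' ∈ A) {s s' : S}
    {h : S → ℝ≥0∞} (hh : M.IsCertificate A s' h) (hs : M.Step s s') :
    ∃ k, M.IsCertificate A s k := by
  classical
  have hle : ∀ t, (if t ∈ M.lost A then 1 else M.expect h t) ≤ h t := by
    intro t
    split_ifs with ht
    · exact (hh.eq_one t ht).ge
    · exact hh.expect_le t ht
  have hs' : s' ∉ M.lost A := fun hl => hh.lt_one.ne (hh.eq_one s' hl)
  have hsl : s ∉ M.lost A := by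
    rintro (hl | hl)
    · exact hs' (Or.inl (hA s hl s' hs))
    · refine hs' (Or.inr fun ⟨t, ht, hr⟩ => hl ⟨t, ht, hr.head hs⟩)
  refine ⟨fun t => if t ∈ M.lost A then 1 else M.expect h t, ?_, ?_, ?_, ?_⟩
  · intro t ht
    rw [if_neg ht]
    exact expect_mono hle t
  · intro t ht
    exact if_pos ht
  · intro t
    exact (hle t).trans (hh.le_one t)
  · rw [if_neg hsl]
    exact expect_lt_one hh.le_one hs hh.lt_one

variable [Countable S] [MeasurableSpace S] [DiscreteMeasurableSpace S]

instance (s₀ : S) : IsProbabilityMeasure (M.pathMeasure s₀) := by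
  unfold pathMeasure; infer_instance

theorem lintegral_toMeasure_pmf (h : S → ℝ≥0∞) (s : S) :
    ∫⁻ s', h s' ∂(M.pmf s).toMeasure = M.expect h s := by
  rw [lintegral_countable', expect]
  refine tsum_congr fun s' => ?_
  rw [PMF.toMeasure_apply_singleton _ _ (MeasurableSet.singleton _), mul_comm]
  rfl

theorem ae_zero (s₀ : S) : ∀ᵐ σ ∂M.pathMeasure s₀, σ 0 = s₀ := by
  have h := Kernel.traj_map_frestrictLe_apply (X := fun _ => S) (κ := M.stepKernel) 0 0
    (fun _ => s₀)
  rw [Kernel.partialTraj_self, Kernel.id_apply] at h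
  refine ae_of_ae_map (p := fun x : (_ : Finset.Iic 0) → S => x ⟨0, by simp⟩ = s₀)
    (f := Preorder.frestrictLe (π := fun _ => S) 0)
    (Preorder.measurable_frestrictLe 0).aemeasurable ?_
  change ∀ᵐ x ∂(Measure.map (Preorder.frestrictLe 0)
    ((Kernel.traj (X := fun _ => S) M.stepKernel 0) (fun _ => s₀))), _
  rw [h, ae_dirac_iff .of_discrete]

/-- The Markov property, integrated: averaging over the next state given the past. -/
theorem lintegral_succ (s₀ : S) (n : ℕ) (G : ((_ : Finset.Iic n) → S) → S → ℝ≥0∞) :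
    ∫⁻ σ, G (Preorder.frestrictLe n σ) (σ (n + 1)) ∂M.pathMeasure s₀ =
      ∫⁻ σ, M.expect (G (Preorder.frestrictLe n σ)) (σ n) ∂M.pathMeasure s₀ := by
  have h := Kernel.partialTraj_compProd_eq_map_traj (X := fun _ => S) (κ := M.stepKernel)
    (Nat.zero_le n) (x₀ := fun _ => s₀)
  have h1 : ∫⁻ σ, G (Preorder.frestrictLe n σ) (σ (n + 1)) ∂M.pathMeasure s₀ =
      ∫⁻ x, G x.1 x.2 ∂((M.pathMeasure s₀).map
        (fun σ => (Preorder.frestrictLe n σ, σ (n + 1)))) := by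
    exact (lintegral_map (f := fun x : ((_ : Finset.Iic n) → S) × S => G x.1 x.2)
      (g := fun σ : ℕ → S => (Preorder.frestrictLe n σ, σ (n + 1))) Measurable.of_discrete
      ((Preorder.measurable_frestrictLe n).prodMk (measurable_pi_apply _))).symm
  have h2 : ∫⁻ σ, M.expect (G (Preorder.frestrictLe n σ)) (σ n) ∂M.pathMeasure s₀ =
      ∫⁻ x, M.expect (G x) (x ⟨n, Finset.mem_Iic.2 le_rfl⟩) ∂((M.pathMeasure s₀).map
        (Preorder.frestrictLe n)) := by
    exact (lintegral_map (f := fun x : (_ : Finset.Iic n) → S => M.expect (G x) (x ⟨n, Finset.mem_Iic.2 le_rfl⟩))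
      Measurable.of_discrete (Preorder.measurable_frestrictLe n)).symm
  rw [h1, h2]
  unfold pathMeasure
  rw [← h, Kernel.traj_map_frestrictLe_apply, Measure.lintegral_compProd Measurable.of_discrete]
  refine lintegral_congr fun x => ?_
  exact lintegral_toMeasure_pmf _ _

open Classical in
/-- The process `h (σ n)`, frozen at `1` once a state of `B` has been visited. It is a
supermartingale when `h` is superharmonic outside `B`. -/
noncomputable def frozen (B : Set S) (h : S → ℝ≥0∞) (n : ℕ) (σ : ℕ → S) : ℝ≥0∞ :=
  if ∃ i ≤ n, σ i ∈ B then 1 else h (σ n)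

theorem lintegral_frozen_succ_le {B : Set S} {h : S → ℝ≥0∞} (hB : ∀ t ∉ B, M.expect h t ≤ h t)
    (h1 : ∀ t ∈ B, h t = 1) (s₀ : S) (n : ℕ) :
    ∫⁻ σ, frozen B h (n + 1) σ ∂M.pathMeasure s₀ ≤ ∫⁻ σ, frozen B h n σ ∂M.pathMeasure s₀ := by
  classical
  let G : ((_ : Finset.Iic n) → S) → S → ℝ≥0∞ := fun x s => if ∃ i, x i ∈ B then 1 else h s
  have key : ∀ σ : ℕ → S, frozen B h (n + 1) σ = G (Preorder.frestrictLe n σ) (σ (n + 1)) := by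
    intro σ
    have e : (∃ i, Preorder.frestrictLe n σ i ∈ B) ↔ ∃ i ≤ n, σ i ∈ B := by simp
    simp only [G, e, frozen]
    by_cases hn : ∃ i ≤ n, σ i ∈ B
    · obtain ⟨i, hi, hib⟩ := hn
      rw [if_pos ⟨i, by omega, hib⟩, if_pos ⟨i, hi, hib⟩]
    · rw [if_neg hn]
      by_cases hl : σ (n + 1) ∈ B
      · rw [if_pos ⟨n + 1, le_rfl, hl⟩, h1 _ hl]
      · rw [if_neg]
        rintro ⟨i, hi, hib⟩
        rcases Nat.lt_or_ge n i with h' | h'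
        · obtain rfl : i = n + 1 := by omega
          exact hl hib
        · exact hn ⟨i, h', hib⟩
  rw [lintegral_congr key, lintegral_succ s₀ n G]
  refine lintegral_mono fun σ => ?_
  have e : (∃ i, Preorder.frestrictLe n σ i ∈ B) ↔ ∃ i ≤ n, σ i ∈ B := by simp
  simp only [G, e, frozen]
  by_cases hn : ∃ i ≤ n, σ i ∈ B
  · simp only [if_pos hn]
    exact expect_le_one (fun _ => le_rfl) _
  · simp only [if_neg hn]
    exact hB _ fun hb => hn ⟨n, le_rfl, hb⟩

theorem not_isDecisive_of_isCertificate {A : Set S} {s₀ : S} {h : S → ℝ≥0∞}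
    (hh : M.IsCertificate A s₀ h) : ¬ M.IsDecisive s₀ A := by
  classical
  set B := M.lost A
  have hbound : ∀ n, ∫⁻ σ, frozen B h n σ ∂M.pathMeasure s₀ ≤ h s₀ := by
    intro n
    induction n with
    | zero =>
      have : ∀ᵐ σ ∂M.pathMeasure s₀, frozen B h 0 σ = h s₀ := by
        filter_upwards [ae_zero (M := M) s₀] with σ hσ
        unfold frozen
        split_ifs with h0
        · obtain ⟨i, hi, hib⟩ := h0
          obtain rfl : i = 0 := by omega
          rw [hσ] at hib
          exact (hh.eq_one _ hib).symm
        · rw [hσ]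
      rw [lintegral_congr_ae this]
      simp
    | succ n ih => exact (lintegral_frozen_succ_le hh.expect_le hh.eq_one s₀ n).trans ih
  have hmeas : ∀ n, MeasurableSet {σ : ℕ → S | ∃ i ≤ n, σ i ∈ B} := by
    intro n
    have : {σ : ℕ → S | ∃ i ≤ n, σ i ∈ B} = ⋃ i ∈ Finset.Iic n, (fun σ => σ i) ⁻¹' B := by
      ext; simp
    rw [this]
    exact Finset.measurableSet_biUnion _ fun i _ => measurable_pi_apply i (.of_discrete)
  have hn : ∀ n, M.pathMeasure s₀ {σ | ∃ i ≤ n, σ i ∈ B} ≤ h s₀ := by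
    intro n
    refine le_trans ?_ (hbound n)
    rw [← lintegral_indicator_one (hmeas n)]
    refine lintegral_mono fun σ => ?_
    by_cases hσ : ∃ i ≤ n, σ i ∈ B <;> simp [Set.indicator, frozen, hσ]
  have hU : M.pathMeasure s₀ {σ | ∃ i, σ i ∈ B} ≤ h s₀ := by
    have : {σ : ℕ → S | ∃ i, σ i ∈ B} = ⋃ n, {σ | ∃ i ≤ n, σ i ∈ B} := by
      ext σ
      simp only [Set.mem_ofPred_eq, Set.mem_iUnion]
      exact ⟨fun ⟨i, hi⟩ => ⟨i, i, le_rfl, hi⟩, fun ⟨_, i, _, hi⟩ => ⟨i, hi⟩⟩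
    rw [this, Monotone.measure_iUnion]
    · exact iSup_le hn
    · exact fun a b hab σ ⟨i, hi, hb⟩ => ⟨i, hi.trans hab, hb⟩
  intro hdec
  have huniv : (1 : ℝ≥0∞) ≤ h s₀ := by
    calc (1 : ℝ≥0∞) = M.pathMeasure s₀ Set.univ := measure_univ.symm
      _ ≤ M.pathMeasure s₀ ({σ | ∀ i, σ i ∉ A ∧ M.CanReach (σ i) A} ∪ {σ | ∃ i, σ i ∈ B}) := by
          refine measure_mono fun σ _ => ?_
          by_cases hσ : ∃ i, σ i ∈ B
          · exact Or.inr hσ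
          · left
            push Not at hσ
            intro i
            have := hσ i
            simpa only [B, lost, Set.mem_ofPred_eq, not_or, not_not] using this
      _ ≤ 0 + h s₀ := (measure_union_le _ _).trans (add_le_add hdec.le hU)
      _ = h s₀ := zero_add _
  exact absurd hh.lt_one (not_lt.2 huniv)

/-- If a state with a certificate is reachable, the chain is not decisive: the certificate is
pulled back along the path. -/
theorem not_isDecisive_of_reach {A : Set S} (hA : ∀ s ∈ A, ∀ s', M.Step s s' → s' ∈ A)
    {s₀ s : S} {h : S → ℝ≥0∞} (hh : M.IsCertificate A s h)
    (hr : Relation.ReflTransGen M.Step s₀ s) : ¬ M.IsDecisive s₀ A := by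
  have : ∃ k, M.IsCertificate A s₀ k := by
    induction hr using Relation.ReflTransGen.head_induction_on with
    | refl => exact ⟨h, hh⟩
    | head hs _ ih =>
      obtain ⟨k, hk⟩ := ih
      exact hk.of_step hA hs
  obtain ⟨k, hk⟩ := this
  exact not_isDecisive_of_isCertificate hk

theorem isDecisive_of_not_canReach {A : Set S} {s₀ : S} (h : ¬ M.CanReach s₀ A) :
    M.IsDecisive s₀ A := by
  refine measure_mono_null (t := {σ | ¬ σ 0 = s₀}) ?_ (ae_iff.1 (ae_zero s₀))
  intro σ hσ h0
  exact h (h0 ▸ (hσ 0).2)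

end MarkovChain

/-! ### Counter programs and primitive recursive functions -/

/-- Elementary operations on counters indexed by `ℕ`. -/
inductive CounterOp : Type
  | nop : CounterOp
  | inc : ℕ → CounterOp
  | dec : ℕ → CounterOp
  | test : ℕ → CounterOp

/-- The relation between the counter values before and after an operation; `dec i` requires the
counter `i` to be positive, `test i` requires it to be zero. -/
def CounterOp.Rel : CounterOp → (ℕ → ℕ) → (ℕ → ℕ) → Prop
  | nop, m, m' => m' = m
  | inc i, m, m' => m' = Function.update m i (m i + 1)
  | dec i, m, m' => 0 < m i ∧ m' = Function.update m i (m i - 1)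
  | test i, m, m' => m i = 0 ∧ m' = m

/-- The relations on counter values that are denoted by regular expressions over the elementary
operations. -/
inductive CounterProg : ((ℕ → ℕ) → (ℕ → ℕ) → Prop) → Prop
  | op (o : CounterOp) : CounterProg o.Rel
  | seq {R T} : CounterProg R → CounterProg T → CounterProg (Relation.Comp R T)
  | star {R} : CounterProg R → CounterProg (Relation.ReflTransGen R)

/-- Some counter program computes the function `F` on the memories satisfying `pre`. -/
def CounterComputes (pre : (ℕ → ℕ) → Prop) (F : (ℕ → ℕ) → (ℕ → ℕ)) : Prop :=
  ∃ R, CounterProg R ∧ ∀ m, pre m → ∀ m', R m m' ↔ m' = F m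

namespace CounterComputes

variable {pre pre' : (ℕ → ℕ) → Prop} {F G : (ℕ → ℕ) → (ℕ → ℕ)}

theorem congr (h : CounterComputes pre F) (hp : ∀ m, pre' m → pre m)
    (hF : ∀ m, pre' m → F m = G m) : CounterComputes pre' G := by
  obtain ⟨R, hR, h⟩ := h
  exact ⟨R, hR, fun m hm m' => by rw [h m (hp m hm), hF m hm]⟩

theorem seq (hF : CounterComputes pre F) (hG : CounterComputes pre' G)
    (hp : ∀ m, pre m → pre' (F m)) : CounterComputes pre (fun m => G (F m)) := by
  obtain ⟨R, hR, hF⟩ := hF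
  obtain ⟨T, hT, hG⟩ := hG
  refine ⟨_, hR.seq hT, fun m hm m' => ?_⟩
  constructor
  · rintro ⟨m₁, h₁, h₂⟩
    obtain rfl := (hF m hm _).1 h₁
    exact (hG _ (hp m hm) _).1 h₂
  · rintro rfl
    exact ⟨F m, (hF m hm _).2 rfl, (hG _ (hp m hm) _).2 rfl⟩

theorem nop : CounterComputes (fun _ => True) (fun m => m) :=
  ⟨_, .op .nop, fun _ _ _ => Iff.rfl⟩

theorem inc (i : ℕ) :
    CounterComputes (fun _ => True) (fun m => Function.update m i (m i + 1)) :=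
  ⟨_, .op (.inc i), fun _ _ _ => Iff.rfl⟩

/-- The loop `while i ≠ 0 do { i := i - 1; B }`, whose body `B` leaves the counter `i` alone, as the
regular expression `(dec i; B)*; test i`. -/
theorem loop {preB : (ℕ → ℕ) → Prop} {B : (ℕ → ℕ) → (ℕ → ℕ)} (i : ℕ)
    (hB : CounterComputes preB B)
    (hstep : ∀ m, pre m → 0 < m i → preB (Function.update m i (m i - 1)) ∧
      pre (B (Function.update m i (m i - 1))) ∧
      B (Function.update m i (m i - 1)) i = m i - 1 ∧
      F m = F (B (Function.update m i (m i - 1))))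
    (hzero : ∀ m, pre m → m i = 0 → F m = m) : CounterComputes pre F := by
  obtain ⟨R, hR, hB⟩ := hB
  refine ⟨_, (((CounterProg.op (.dec i)).seq hR).star).seq (.op (.test i)), fun m hm => ?_⟩
  generalize hN : m i = N
  induction N generalizing m with
  | zero =>
    intro m'
    rw [hzero m hm hN]
    constructor
    · rintro ⟨m₁, h₁, -, rfl⟩
      rcases Relation.ReflTransGen.cases_head h₁ with rfl | ⟨_, ⟨_, ⟨hpos, _⟩, _⟩, _⟩
      · rfl
      · omega
    · rintro rfl
      exact ⟨m', .refl, hN, rfl⟩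
  | succ N ih =>
    intro m'
    obtain ⟨h1, h2, h3, h4⟩ := hstep m hm (by omega)
    rw [h4, ← ih _ h2 (by omega) m']
    constructor
    · rintro ⟨m₁, h₁, ht⟩
      rcases Relation.ReflTransGen.cases_head h₁ with rfl | ⟨_, ⟨_, ⟨hpos, rfl⟩, h₂⟩, h₃⟩
      · exact absurd ht.1 (by omega)
      · obtain rfl := (hB _ h1 _).1 h₂
        exact ⟨_, h₃, ht⟩
    · rintro ⟨m₁, h₁, ht⟩
      exact ⟨m₁, h₁.head ⟨_, ⟨by omega, rfl⟩, (hB _ h1 _).2 rfl⟩, ht⟩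

theorem clear (i : ℕ) : CounterComputes (fun _ => True) (fun m => Function.update m i 0) := by
  refine loop i nop ?_ ?_
  · intro m _ _
    simp
  · intro m _ h
    rw [← h, Function.update_eq_self]

/-- Adding the counter `i` to the counter `j` and clearing `i`. -/
theorem move {i j : ℕ} (hij : i ≠ j) : CounterComputes (fun _ => True)
    (fun m => Function.update (Function.update m j (m j + m i)) i 0) := by
  refine loop i (inc j) ?_ ?_
  · intro m _ h
    refine ⟨trivial, trivial, ?_, ?_⟩
    · simp [hij]
    · funext l
      simp only [Function.update_apply]
      grind
  · intro m _ h
    funext l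
    simp only [Function.update_apply]
    grind

/-- Adding the counter `i` to the counter `j`, using `t` as a scratch counter. -/
theorem copy {i j t : ℕ} (hij : i ≠ j) (hit : i ≠ t) (hjt : j ≠ t) :
    CounterComputes (fun m => m t = 0) (fun m => Function.update m j (m j + m i)) := by
  have h1 : CounterComputes (fun _ => True) (fun m => Function.update (Function.update
      (Function.update m j (m j + m i)) t (m t + m i)) i 0) := by
    refine loop i ((inc j).seq (inc t) fun _ _ => trivial) ?_ ?_
    · intro m _ h
      refine ⟨trivial, trivial, ?_, ?_⟩
      · simp [hij, hit]
      · funext l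
        simp only [Function.update_apply]
        grind
    · intro m _ h
      funext l
      simp only [Function.update_apply]
      grind
  refine (h1.seq (move hit.symm) fun _ _ => trivial).congr (fun _ _ => trivial) ?_
  intro m hm
  funext l
  simp only [Function.update_apply]
  grind

theorem clear_range (k n : ℕ) : CounterComputes (fun _ => True)
    (fun m j => if k ≤ j ∧ j < k + n then 0 else m j) := by
  induction n with
  | zero => exact nop.congr (fun _ _ => trivial) fun m _ => by funext j; grind
  | succ n ih =>
    refine (ih.seq (clear (k + n)) fun _ _ => trivial).congr (fun _ _ => trivial) ?_
    intro m _
    funext j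
    simp only [Function.update_apply]
    grind

end CounterComputes

/-- The `n`-ary function `f` can be computed with stack discipline: if the arguments are in counters
`xs i < k` and all counters from `k` on are zero, some program puts the value of `f` into the
counter `k` and restores every other counter. -/
def StackComputable {n : ℕ} (f : List.Vector ℕ n → ℕ) : Prop :=
  ∀ (k : ℕ) (xs : Fin n → ℕ), (∀ i, xs i < k) →
    CounterComputes (fun m => ∀ j ≥ k, m j = 0)
      (fun m => Function.update m k (f (List.Vector.ofFn fun i => m (xs i))))

namespace StackComputable

theorem get {n : ℕ} (i : Fin n) : StackComputable (fun v : List.Vector ℕ n => v.get i) := by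
  intro k xs hxs
  refine (CounterComputes.copy (i := xs i) (j := k) (t := k + 1) (hxs i).ne
    ((hxs i).trans (by omega)).ne (by omega)).congr ?_ ?_
  · intro m hm
    exact hm _ (by omega)
  · intro m hm
    simp [hm k le_rfl]

theorem zero : StackComputable (fun _ : List.Vector ℕ 0 => 0) := by
  intro k xs _
  refine CounterComputes.nop.congr (fun _ _ => trivial) ?_
  intro m hm
  change m = Function.update m k 0
  rw [← hm k le_rfl, Function.update_eq_self]

theorem succ : StackComputable (fun v : List.Vector ℕ 1 => Nat.succ v.head) := by
  intro k xs hxs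
  refine ((get (0 : Fin 1) k xs hxs).seq (.inc k) fun _ _ => trivial).congr (fun _ h => h) ?_
  intro m _
  simp

theorem comp {n l : ℕ} {f : List.Vector ℕ n → ℕ} (g : Fin n → List.Vector ℕ l → ℕ)
    (hf : StackComputable f) (hg : ∀ i, StackComputable (g i)) :
    StackComputable (fun a => f (List.Vector.ofFn fun i => g i a)) := by
  intro k xs hxs
  -- The values of the `g i` are stored in the counters `k + 1 + i`.
  have hargs : ∀ t ≤ n, CounterComputes (fun m => ∀ j ≥ k, m j = 0)
      (fun m j => if h : k + 1 ≤ j ∧ j < k + 1 + t ∧ j - (k + 1) < n then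
        g ⟨j - (k + 1), h.2.2⟩ (List.Vector.ofFn fun i => m (xs i)) else m j) := by
    intro t
    induction t with
    | zero =>
      intro _
      refine CounterComputes.nop.congr (fun _ _ => trivial) fun m _ => ?_
      funext j
      rw [dif_neg (by omega)]
    | succ t ih =>
      intro ht
      refine ((ih (by omega)).seq (hg ⟨t, ht⟩ (k + 1 + t) xs fun i => ?_) ?_).congr
        (fun _ h => h) ?_
      · have := hxs i
        omega
      · intro m hm j hj
        beta_reduce
        rw [dif_neg (by omega)]
        exact hm j (by omega)
      · intro m hm
        have hv : ∀ i, ¬ (k + 1 ≤ xs i ∧ xs i < k + 1 + t ∧ xs i - (k + 1) < n) := by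
          intro i
          have := hxs i
          omega
        funext j
        simp only [hv, dite_false, Function.update_apply]
        by_cases hj : j = k + 1 + t
        · subst hj
          rw [if_pos rfl, dif_pos (by omega)]
          congr 2
          simp
        · rw [if_neg hj]
          by_cases h' : k + 1 ≤ j ∧ j < k + 1 + t ∧ j - (k + 1) < n
          · rw [dif_pos h', dif_pos (by omega)]
          · rw [dif_neg h', dif_neg (by omega)]
  have h1 := (hargs n le_rfl).seq (hf (k + 1 + n) (fun i => k + 1 + i) fun i => by omega)
    (by
      intro m hm j hj
      beta_reduce
      rw [dif_neg (by omega)]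
      exact hm j (by omega))
  have h2 := (h1.seq (.move (i := k + 1 + n) (j := k) (by omega)) fun _ _ => trivial).seq
    (.clear_range (k + 1) n) fun _ _ => trivial
  refine h2.congr (fun _ h => h) fun m hm => ?_
  have hv : (List.Vector.ofFn fun i : Fin n =>
      if h : k + 1 ≤ k + 1 + (i : ℕ) ∧ k + 1 + (i : ℕ) < k + 1 + n ∧ k + 1 + (i : ℕ) - (k + 1) < n
      then g ⟨k + 1 + (i : ℕ) - (k + 1), h.2.2⟩ (List.Vector.ofFn fun i => m (xs i))
      else m (k + 1 + i)) = List.Vector.ofFn fun i =>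
        g i (List.Vector.ofFn fun i => m (xs i)) := by
    congr 1
    funext i
    rw [dif_pos (by omega)]
    congr 2
    simp
  funext j
  simp only [hv, Function.update_apply]
  have hk := hm k le_rfl
  have hne : k ≠ k + 1 + n := by omega
  by_cases h0 : j = k
  · subst h0
    simp [hk, hne]
  · by_cases h4 : k + 1 ≤ j ∧ j < k + 1 + n
    · simp [h4, h0, hm j (by omega)]
    · by_cases h5 : j = k + 1 + n
      · subst h5
        simp [hne.symm, hm (k + 1 + n) (by omega)]
      · have : ¬ (k + 1 ≤ j ∧ j < k + 1 + n ∧ j - (k + 1) < n) := by omega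
        rw [if_neg h4, if_neg h5, if_neg h0, if_neg h5, dif_neg this, if_neg h0]

/-- `c` rounds of the recursion `(y, a) ↦ (y + 1, g y a)`, returning the last `a`. -/
def precLoop (g : ℕ → ℕ → ℕ) : ℕ → ℕ → ℕ → ℕ
  | _, a, 0 => a
  | y, a, c + 1 => precLoop g (y + 1) (g y a) c

theorem precLoop_rec (g : ℕ → ℕ → ℕ) (a y c : ℕ) :
    precLoop g y (Nat.rec a g y) c = Nat.rec a g (y + c) := by
  induction c generalizing y with
  | zero => rfl
  | succ c ih =>
    rw [precLoop, show y + (c + 1) = y + 1 + c by omega, ← ih (y + 1)]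

theorem prec {n : ℕ} {f : List.Vector ℕ n → ℕ} {g : List.Vector ℕ (n + 2) → ℕ}
    (hf : StackComputable f) (hg : StackComputable g) :
    StackComputable (fun v : List.Vector ℕ (n + 1) =>
      v.head.rec (f v.tail) fun y IH => g (y ::ᵥ IH ::ᵥ v.tail)) := by
  intro k xs hxs
  have hf' := hf k (fun i => xs i.succ) fun i => hxs _
  -- Counter `k` is the accumulator, `k + 1` counts down, `k + 2` counts up.
  have hg' := hg (k + 3) (Fin.cons (k + 2) (Fin.cons k fun i => xs i.succ)) (by
    intro i
    refine Fin.cases (by simp) (fun i => ?_) i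
    refine Fin.cases (by simp) (fun i => ?_) i
    have := hxs i.succ
    simp only [Fin.cons_succ]
    omega)
  have hbody : CounterComputes (fun m => ∀ j ≥ k + 3, m j = 0) (fun m => Function.update
      (Function.update m k (g (m (k + 2) ::ᵥ m k ::ᵥ List.Vector.ofFn fun i => m (xs i.succ))))
      (k + 2) (m (k + 2) + 1)) := by
    refine (((hg'.seq (.clear k) fun _ _ => trivial).seq
      (.move (i := k + 3) (j := k) (by omega)) fun _ _ => trivial).seq (.inc (k + 2))
      fun _ _ => trivial).congr (fun _ h => h) fun m hm => ?_
    have h3 := hm (k + 3) le_rfl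
    funext j
    simp only [List.Vector.ofFn, Fin.cons_zero, Fin.cons_succ, Function.update_apply]
    by_cases h0 : j = k
    · subst h0
      simp
    · by_cases h4 : j = k + 2
      · subst h4
        simp
      · by_cases h5 : j = k + 3
        · subst h5
          simp [h3]
        · simp [h0, h4, h5]
  have hloop : CounterComputes (fun m => ∀ j ≥ k + 3, m j = 0) (fun m => Function.update
      (Function.update (Function.update m k (precLoop
        (fun y a => g (y ::ᵥ a ::ᵥ List.Vector.ofFn fun i => m (xs i.succ)))
        (m (k + 2)) (m k) (m (k + 1)))) (k + 2) (m (k + 2) + m (k + 1))) (k + 1) 0) := by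
    have hx : ∀ i : Fin n, xs i.succ ≠ k ∧ xs i.succ ≠ k + 1 ∧ xs i.succ ≠ k + 2 := by
      intro i
      have := hxs i.succ
      omega
    refine CounterComputes.loop (k + 1) hbody ?_ ?_
    · intro m hm hpos
      refine ⟨?_, ?_, ?_, ?_⟩
      · intro j hj
        rw [Function.update_of_ne (by omega)]
        exact hm j hj
      · intro j hj
        rw [Function.update_of_ne (by omega), Function.update_of_ne (by omega),
          Function.update_of_ne (by omega)]
        exact hm j hj
      · simp
      · obtain ⟨c, hc⟩ : ∃ c, m (k + 1) = c + 1 := ⟨m (k + 1) - 1, by omega⟩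
        funext j
        simp only [Function.update_apply, hx, hc, precLoop]
        by_cases h0 : j = k
        · subst h0
          simp
        · by_cases h1 : j = k + 1
          · subst h1
            simp
          · by_cases h2 : j = k + 2
            · subst h2
              simp
              omega
            · simp [h0, h1, h2]
    · intro m hm h0
      funext j
      simp only [Function.update_apply, h0, precLoop]
      grind
  have hinit := (hf'.seq (.copy (i := xs 0) (j := k + 1) (t := k + 2) (by have := hxs 0; omega)
    (by have := hxs 0; omega) (by omega)) fun m hm => by
      rw [Function.update_of_ne (by omega)]; exact hm _ (by omega))
  refine ((hinit.seq hloop fun m hm j hj => ?_).seq (.clear (k + 2)) fun _ _ => trivial).congr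
    (fun _ h => h) fun m hm => ?_
  · rw [Function.update_of_ne (by omega), Function.update_of_ne (by omega)]
    exact hm j (by omega)
  · have hx : ∀ i : Fin (n + 1), xs i ≠ k ∧ xs i ≠ k + 1 ∧ xs i ≠ k + 2 := by
      intro i
      have := hxs i
      omega
    have h0 := hm k le_rfl
    have h1 := hm (k + 1) (by omega)
    have h2 := hm (k + 2) (by omega)
    have hrec : ∀ a g c, precLoop g 0 a c = Nat.rec a g c := by
      intro a g c
      have h := precLoop_rec g a 0 c
      rwa [Nat.zero_add] at h
    funext j
    simp only [Function.update_apply, hx, h1, h2, if_false]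
    by_cases e0 : j = k
    · subst e0
      simp [List.Vector.ofFn, hrec]
    · by_cases e1 : j = k + 1
      · subst e1
        simp [h1]
      · by_cases e2 : j = k + 2
        · subst e2
          simp [h2]
        · simp [e0, e1, e2]

theorem of_primrec {n : ℕ} {f : List.Vector ℕ n → ℕ} (hf : Nat.Primrec' f) :
    StackComputable f := by
  induction hf with
  | zero => exact zero
  | succ => exact succ
  | get i => exact get i
  | comp g _ _ hf hg => exact comp g hf hg
  | prec _ _ hf hg => exact prec hf hg

end StackComputable

/-- Semi-decision by nondeterminism: guess `k` in counter `1`, compute `f k x` into counter `2`,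
test it for zero, and clear the counters. -/
theorem exists_counterProg_of_primrec {f : ℕ → ℕ → ℕ} (hf : Primrec₂ f) :
    ∃ R, CounterProg R ∧ ∀ x m', R (Pi.single 0 x) m' ↔ m' = 0 ∧ ∃ k, f k x = 0 := by
  obtain ⟨P, hP, hPs⟩ := StackComputable.of_primrec (Nat.Primrec'.prim_iff₂.2 hf) 2 ![1, 0]
    (by simp [Fin.forall_fin_two])
  obtain ⟨T, hT, hTs⟩ := CounterComputes.clear_range 0 2
  have hguess : ∀ m m' : ℕ → ℕ, Relation.ReflTransGen (CounterOp.inc 1).Rel m m' ↔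
      ∃ k, m' = Function.update m 1 (m 1 + k) := by
    intro m m'
    constructor
    · intro h
      induction h with
      | refl => exact ⟨0, by simp⟩
      | tail _ h ih =>
        obtain ⟨k, rfl⟩ := ih
        obtain rfl := h
        exact ⟨k + 1, by simp [Nat.add_assoc]⟩
    · rintro ⟨k, rfl⟩
      induction k with
      | zero => simpa using Relation.ReflTransGen.refl
      | succ k ih =>
        refine ih.tail ?_
        simp [CounterOp.Rel, Nat.add_assoc]
  refine ⟨_, (((CounterProg.op (.inc 1)).star.seq hP).seq (.op (.test 2))).seq hT, fun x m' => ?_⟩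
  have hpre : ∀ k, ∀ j ≥ 2, Function.update (Pi.single 0 x : ℕ → ℕ) 1
      ((Pi.single 0 x : ℕ → ℕ) 1 + k) j = 0 := by
    intro k j hj
    rw [Function.update_of_ne (by omega), Pi.single_eq_of_ne (by omega)]
  have hval : ∀ k, (Function.update (Pi.single 0 x : ℕ → ℕ) 1 ((Pi.single 0 x : ℕ → ℕ) 1 + k)) =
      fun j => if j = 0 then x else if j = 1 then k else 0 := by
    intro k
    funext j
    simp only [Function.update_apply, Pi.single_apply]
    grind
  constructor
  · rintro ⟨m₃, ⟨m₂, ⟨m₁, h₁, h₂⟩, h₃, rfl⟩, h₄⟩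
    obtain ⟨k, rfl⟩ := (hguess _ _).1 h₁
    have h₂ := (hPs _ (hpre k) _).1 h₂
    have h₄ := (hTs _ trivial _).1 h₄
    rw [hval] at h₂
    subst h₂
    have hz : f k x = 0 := by simpa [List.Vector.ofFn] using h₃
    refine ⟨?_, k, hz⟩
    subst h₄
    funext j
    simp only [Function.update_apply, Pi.zero_apply]
    grind
  · rintro ⟨rfl, k, hk⟩
    refine ⟨_, ⟨_, ⟨_, (hguess _ _).2 ⟨k, rfl⟩, (hPs _ (hpre k) _).2 rfl⟩, ?_, rfl⟩,
      (hTs _ trivial _).2 ?_⟩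
    · rw [hval]
      simpa [List.Vector.ofFn] using hk
    · rw [hval]
      funext j
      simp only [Function.update_apply, Pi.zero_apply]
      by_cases h2 : j = 2
      · subst h2
        simpa [List.Vector.ofFn] using hk.symm
      · grind

/-! ### Control graphs of counter programs -/

/-- One step in a control graph whose edges carry counter operations. -/
def GraphStep {Q : Type} (E : Set (Q × CounterOp × Q)) (s s' : Q × (ℕ → ℕ)) : Prop :=
  ∃ o, (s.1, o, s'.1) ∈ E ∧ o.Rel s.2 s'.2

theorem GraphStep.lift {Q Q' : Type} {E : Set (Q × CounterOp × Q)} {E' : Set (Q' × CounterOp × Q')}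
    (f : Q → Q') (hf : ∀ p o q, (p, o, q) ∈ E → (f p, o, f q) ∈ E') {s s' : Q × (ℕ → ℕ)}
    (h : Relation.ReflTransGen (GraphStep E) s s') :
    Relation.ReflTransGen (GraphStep E') (f s.1, s.2) (f s'.1, s'.2) :=
  Relation.ReflTransGen.lift (fun s : Q × (ℕ → ℕ) => (f s.1, s.2))
    (fun _ _ ⟨o, ho, hr⟩ => ⟨o, hf _ _ _ ho, hr⟩) _ _ h

/-- Every counter program is realized by a finite control graph with an entry and an exit, just as
every regular expression is realized by a finite automaton. -/
theorem CounterProg.exists_graph {R : (ℕ → ℕ) → (ℕ → ℕ) → Prop} (h : CounterProg R) :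
    ∃ (Q : Type) (_ : Finite Q) (E : Set (Q × CounterOp × Q)) (p q : Q), E.Finite ∧
      ∀ m m', Relation.ReflTransGen (GraphStep E) (p, m) (q, m') ↔ R m m' := by
  induction h with
  | op o =>
    refine ⟨Bool, inferInstance, {(false, o, true)}, false, true, Set.finite_singleton _, ?_⟩
    intro m m'
    constructor
    · intro h
      have inv : ∀ s : Bool × (ℕ → ℕ), Relation.ReflTransGen (GraphStep {(false, o, true)})
          (false, m) s → if s.1 then o.Rel m s.2 else s.2 = m := by
        intro s hs
        induction hs with
        | refl => simp
        | @tail b c _ hbc ih =>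
          obtain ⟨o', ho', hr⟩ := hbc
          simp only [Set.mem_singleton_iff, Prod.mk.injEq] at ho'
          obtain ⟨h1, rfl, h2⟩ := ho'
          simp only [h1, Bool.false_eq_true, if_false] at ih
          simpa [h2, ih] using hr
      simpa using inv _ h
    · intro h
      exact .single ⟨o, rfl, h⟩
  | @seq R T _ _ ih1 ih2 =>
    obtain ⟨Q₁, _, E₁, p₁, q₁, hE₁, h₁⟩ := ih1
    obtain ⟨Q₂, _, E₂, p₂, q₂, hE₂, h₂⟩ := ih2
    let E : Set ((Q₁ ⊕ Q₂) × CounterOp × (Q₁ ⊕ Q₂)) :=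
      (fun x => (Sum.inl x.1, x.2.1, Sum.inl x.2.2)) '' E₁ ∪
        ((fun x => (Sum.inr x.1, x.2.1, Sum.inr x.2.2)) '' E₂ ∪ {(.inl q₁, .nop, .inr p₂)})
    refine ⟨Q₁ ⊕ Q₂, inferInstance, E, .inl p₁, .inr q₂,
      (hE₁.image _).union ((hE₂.image _).union (Set.finite_singleton _)), ?_⟩
    intro m m'
    constructor
    · intro h
      have inv : ∀ s : (Q₁ ⊕ Q₂) × (ℕ → ℕ), Relation.ReflTransGen (GraphStep E) (.inl p₁, m) s →
          (∃ x, s.1 = .inl x ∧ Relation.ReflTransGen (GraphStep E₁) (p₁, m) (x, s.2)) ∨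
          (∃ x m₁, s.1 = .inr x ∧ R m m₁ ∧
            Relation.ReflTransGen (GraphStep E₂) (p₂, m₁) (x, s.2)) := by
        intro s hs
        induction hs with
        | refl => exact .inl ⟨_, rfl, .refl⟩
        | @tail b c _ hbc ih =>
          obtain ⟨b, mb⟩ := b
          obtain ⟨c, mc⟩ := c
          obtain ⟨o, ho, hr⟩ := hbc
          rcases ho with ⟨⟨x, o', y⟩, hx, heq⟩ | ⟨⟨x, o', y⟩, hx, heq⟩ | heq
          · simp only [Prod.mk.injEq] at heq
            obtain ⟨rfl, rfl, rfl⟩ := heq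
            rcases ih with ⟨x', hx', hxr⟩ | ⟨x', _, hx', _⟩
            · obtain rfl := Sum.inl_injective hx'
              exact .inl ⟨y, rfl, hxr.tail ⟨_, hx, hr⟩⟩
            · simp at hx'
          · simp only [Prod.mk.injEq] at heq
            obtain ⟨rfl, rfl, rfl⟩ := heq
            rcases ih with ⟨x', hx', _⟩ | ⟨x', m₁, hx', hR, hxr⟩
            · simp at hx'
            · obtain rfl := Sum.inr_injective hx'
              exact .inr ⟨y, m₁, rfl, hR, hxr.tail ⟨_, hx, hr⟩⟩
          · simp only [Set.mem_singleton_iff, Prod.mk.injEq] at heq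
            obtain ⟨rfl, rfl, rfl⟩ := heq
            obtain rfl : mc = mb := hr
            rcases ih with ⟨x', hx', hxr⟩ | ⟨x', _, hx', _⟩
            · obtain rfl := Sum.inl_injective hx'
              exact .inr ⟨p₂, mc, rfl, (h₁ _ _).1 hxr, .refl⟩
            · simp at hx'
      rcases inv _ h with ⟨x, hx, _⟩ | ⟨x, m₁, hx, hR, hr⟩
      · simp at hx
      · obtain rfl := Sum.inr_injective hx
        exact ⟨m₁, hR, (h₂ _ _).1 hr⟩
    · rintro ⟨m₁, hR, hT⟩
      have a : Relation.ReflTransGen (GraphStep E) (.inl p₁, m) (.inl q₁, m₁) :=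
        GraphStep.lift (s := (p₁, m)) (s' := (q₁, m₁)) Sum.inl
          (fun p o q hx => .inl ⟨(p, o, q), hx, rfl⟩) ((h₁ _ _).2 hR)
      have b : Relation.ReflTransGen (GraphStep E) (.inr p₂, m₁) (.inr q₂, m') :=
        GraphStep.lift (s := (p₂, m₁)) (s' := (q₂, m')) Sum.inr
          (fun p o q hx => .inr (.inl ⟨(p, o, q), hx, rfl⟩)) ((h₂ _ _).2 hT)
      have c : GraphStep E (.inl q₁, m₁) (.inr p₂, m₁) := ⟨.nop, .inr (.inr rfl), rfl⟩
      exact (a.tail c).trans b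
  | @star R _ ih =>
    obtain ⟨Q, _, E₁, p, q, hE₁, h₁⟩ := ih
    let E : Set (Option Q × CounterOp × Option Q) :=
      (fun x => (some x.1, x.2.1, some x.2.2)) '' E₁ ∪
        ({(none, .nop, some p)} ∪ {(some q, .nop, none)})
    refine ⟨Option Q, inferInstance, E, none, none,
      (hE₁.image _).union ((Set.finite_singleton _).union (Set.finite_singleton _)), ?_⟩
    intro m m'
    constructor
    · intro h
      have inv : ∀ s : Option Q × (ℕ → ℕ), Relation.ReflTransGen (GraphStep E) (none, m) s →
          (s.1 = none ∧ Relation.ReflTransGen R m s.2) ∨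
          (∃ x m₁, s.1 = some x ∧ Relation.ReflTransGen R m m₁ ∧
            Relation.ReflTransGen (GraphStep E₁) (p, m₁) (x, s.2)) := by
        intro s hs
        induction hs with
        | refl => exact .inl ⟨rfl, .refl⟩
        | @tail b c _ hbc ih =>
          obtain ⟨b, mb⟩ := b
          obtain ⟨c, mc⟩ := c
          obtain ⟨o, ho, hr⟩ := hbc
          rcases ho with ⟨⟨x, o', y⟩, hx, heq⟩ | heq | heq
          · simp only [Prod.mk.injEq] at heq
            obtain ⟨rfl, rfl, rfl⟩ := heq
            rcases ih with ⟨hx', _⟩ | ⟨x', m₁, hx', hR, hxr⟩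
            · simp at hx'
            · obtain rfl := Option.some_injective _ hx'
              exact .inr ⟨y, m₁, rfl, hR, hxr.tail ⟨_, hx, hr⟩⟩
          · simp only [Set.mem_singleton_iff, Prod.mk.injEq] at heq
            obtain ⟨rfl, rfl, rfl⟩ := heq
            obtain rfl : mc = mb := hr
            rcases ih with ⟨_, hR⟩ | ⟨x', m₁, hx', _⟩
            · exact .inr ⟨p, mc, rfl, hR, .refl⟩
            · simp at hx'
          · simp only [Set.mem_singleton_iff, Prod.mk.injEq] at heq
            obtain ⟨rfl, rfl, rfl⟩ := heq
            obtain rfl : mc = mb := hr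
            rcases ih with ⟨hx', _⟩ | ⟨x', m₁, hx', hR, hxr⟩
            · simp at hx'
            · obtain rfl := Option.some_injective _ hx'
              exact .inl ⟨rfl, hR.tail ((h₁ _ _).1 hxr)⟩
      rcases inv _ h with ⟨_, hR⟩ | ⟨x, _, hx, _⟩
      · exact hR
      · simp at hx
    · intro h
      induction h with
      | refl => exact .refl
      | @tail b c _ hbc ih =>
        have a : Relation.ReflTransGen (GraphStep E) (some p, b) (some q, c) :=
          GraphStep.lift (s := (p, b)) (s' := (q, c)) some
            (fun p o q hx => .inl ⟨(p, o, q), hx, rfl⟩) ((h₁ _ _).2 hbc)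
        have enter : GraphStep E (none, b) (some p, b) := ⟨.nop, .inr (.inl rfl), rfl⟩
        have leave : GraphStep E (some q, c) (none, c) := ⟨.nop, .inr (.inr rfl), rfl⟩
        exact ((ih.tail enter).trans a).tail leave

/-! ### One-step behaviour of probabilistic counter machines -/

namespace Transition

/-- The control state in which a transition can be fired. -/
def source {n d : ℕ} : Transition n d → Fin n
  | zero q _ _ _ => q
  | pre q _ _ _ => q

theorem Enabled.source_eq {n d : ℕ} {t : Transition n d} {s : Config n d} (h : t.Enabled s) :
    t.source = s.1 := by
  cases t <;> exact h.1.symm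

end Transition

namespace PCM

variable {n d : ℕ} (C : PCM n d)

theorem mem_En {s : Config n d} {t : Transition n d} : t ∈ C.En s ↔ t ∈ C.Δ ∧ t.Enabled s := by
  classical
  simp [En]

theorem W_pos_of_mem_En {s : Config n d} {t : Transition n d} (ht : t ∈ C.En s) :
    0 < C.W t s.2 := C.W_pos t (C.mem_En.1 ht).1 _

theorem weight_pos {s : Config n d} (h : (C.En s).Nonempty) : 0 < C.weight s :=
  Finset.sum_pos (fun _ ht => C.W_pos_of_mem_En ht) h

theorem step_fire {s : Config n d} {t : Transition n d} (ht : t ∈ C.Δ) (hs : t.Enabled s) :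
    C.chain.Step s (t.fire s) := by
  classical
  have hmem : t ∈ C.En s := C.mem_En.2 ⟨ht, hs⟩
  have hne : C.En s ≠ ∅ := Finset.ne_empty_of_mem hmem
  change 0 < C.prob s (t.fire s)
  rw [prob, if_neg hne]
  have h1 := C.weight_pos ⟨t, hmem⟩
  refine mul_pos (by positivity) (Finset.sum_pos ?_ ⟨t, ?_⟩)
  · intro u hu
    exact_mod_cast C.W_pos_of_mem_En (Finset.mem_filter.1 hu).1
  · exact Finset.mem_filter.2 ⟨hmem, rfl⟩

theorem step_cases {s s' : Config n d} (h : C.chain.Step s s') :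
    (∃ t ∈ C.Δ, t.Enabled s ∧ t.fire s = s') ∨ s' = s := by
  classical
  change 0 < C.prob s s' at h
  rw [prob] at h
  split_ifs at h with h1 h2
  · exact .inr h2
  · exact absurd h (lt_irrefl _)
  · left
    by_contra hno
    push Not at hno
    rw [Finset.filter_false_of_mem] at h
    · simp at h
    · intro t ht
      exact hno t (C.mem_En.1 ht).1 (C.mem_En.1 ht).2

theorem expect_chain (h : Config n d → ℝ≥0∞) {s : Config n d} (hne : (C.En s).Nonempty) :
    C.chain.expect h s =
      (C.weight s : ℝ≥0∞)⁻¹ * ∑ t ∈ C.En s, (C.W t s.2 : ℝ≥0∞) * h (t.fire s) := by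
  classical
  have hw := (C.weight_pos hne).ne'
  have hp : ∀ s', ((C.prob s s' : ℝ≥0) : ℝ≥0∞) * h s' = (C.weight s : ℝ≥0∞)⁻¹ *
      ∑ t ∈ C.En s, if s' = t.fire s then (C.W t s.2 : ℝ≥0∞) * h (t.fire s) else 0 := by
    intro s'
    rw [prob, if_neg hne.ne_empty]
    push_cast
    rw [ENNReal.coe_inv (by exact_mod_cast hw), mul_assoc, Finset.sum_mul, Finset.sum_filter]
    push_cast
    congr 1
    refine Finset.sum_congr rfl fun t _ => ?_
    by_cases ht : t.fire s = s'
    · simp [ht]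
    · rw [if_neg ht, if_neg (Ne.symm ht)]
  change ∑' s', ((C.prob s s' : ℝ≥0) : ℝ≥0∞) * h s' = _
  simp_rw [hp]
  rw [ENNReal.tsum_mul_left, Summable.tsum_finsetSum fun _ _ => ENNReal.summable]
  congr 1
  refine Finset.sum_congr rfl fun t _ => ?_
  exact tsum_ite_eq _ _

end PCM

/-! ### From control graphs to probabilistic counter machines -/

/-- Counter values on an initial segment, extended by zero. -/
def extendCounters {d : ℕ} (m : Fin d → ℕ) : ℕ → ℕ := fun i => if h : i < d then m ⟨i, h⟩ else 0

theorem extendCounters_zero {d : ℕ} : extendCounters (0 : Fin d → ℕ) = 0 := by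
  funext i
  simp [extendCounters]

theorem extendCounters_injective {d : ℕ} :
    Function.Injective (extendCounters : (Fin d → ℕ) → ℕ → ℕ) := by
  intro m m' h
  funext i
  simpa [extendCounters] using congrFun h i

theorem extendCounters_single {D x : ℕ} :
    extendCounters (Pi.single 0 x : Fin (D + 1) → ℕ) = Pi.single 0 x := by
  funext i
  cases i with
  | zero => simp [extendCounters]
  | succ i =>
    simp only [extendCounters, Pi.single_apply, Fin.ext_iff]
    simp

theorem extendCounters_update {D : ℕ} (m : Fin (D + 1) → ℕ) {i : ℕ} (hi : i < D + 1) (v : ℕ) :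
    extendCounters (Function.update m (Fin.ofNat (D + 1) i) v) =
      Function.update (extendCounters m) i v := by
  funext j
  simp only [extendCounters, Function.update_apply, Fin.ext_iff, Fin.val_ofNat,
    Nat.mod_eq_of_lt hi]
  grind

theorem extendCounters_ofNat {D : ℕ} (m : Fin (D + 1) → ℕ) {i : ℕ} (hi : i < D + 1) :
    extendCounters m i = m (Fin.ofNat (D + 1) i) := by
  rw [extendCounters, dif_pos hi]
  congr 1
  simp [Fin.ext_iff, Nat.mod_eq_of_lt hi]

/-- All counters used by the operation are at most `D`. -/
def CounterOp.Bounded (D : ℕ) : CounterOp → Prop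
  | nop => True
  | inc i => i < D + 1
  | dec i => i < D + 1
  | test i => i < D + 1

theorem CounterOp.exists_bounded {Q : Type} {E : Set (Q × CounterOp × Q)} (hE : E.Finite) :
    ∃ D, ∀ x ∈ E, x.2.1.Bounded D := by
  have h : ∀ o : CounterOp, ∃ D, ∀ D' ≥ D, o.Bounded D' := by
    intro o
    cases o with
    | nop => exact ⟨0, fun _ _ => trivial⟩
    | inc i => exact ⟨i, fun D' h => Nat.lt_succ_of_le h⟩
    | dec i => exact ⟨i, fun D' h => Nat.lt_succ_of_le h⟩
    | test i => exact ⟨i, fun D' h => Nat.lt_succ_of_le h⟩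
  choose b hb using h
  obtain ⟨D, hD⟩ := (hE.image fun x => b x.2.1).bddAbove
  exact ⟨D, fun x hx => hb _ D (hD ⟨x, hx, rfl⟩)⟩

/-- The transition from `p` to `q` that performs an operation on the counters `0, …, D`. -/
def CounterOp.toTransition {n D : ℕ} (p q : Fin n) : CounterOp → Transition n (D + 1)
  | nop => .pre p 0 0 q
  | inc i => .pre p 0 (Pi.single (Fin.ofNat (D + 1) i) 1) q
  | dec i => .pre p (Pi.single (Fin.ofNat (D + 1) i) 1) 0 q
  | test i => .zero p (Fin.ofNat (D + 1) i) 0 q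

section Vector

variable {D : ℕ} (m : Fin (D + 1) → ℕ) (i : Fin (D + 1))

theorem add_single_one : m + Pi.single i 1 = Function.update m i (m i + 1) := by
  funext j
  by_cases h : j = i
  · subst h; simp
  · simp [h]

theorem sub_single_one : m - Pi.single i 1 = Function.update m i (m i - 1) := by
  funext j
  by_cases h : j = i
  · subst h; simp
  · simp [h]

theorem single_one_le_iff : Pi.single i 1 ≤ m ↔ 0 < m i := by
  constructor
  · intro h
    have := h i
    simp at this
    omega
  · intro h j
    by_cases hj : j = i
    · subst hj; simp; omega
    · simp [hj]

end Vector

namespace CounterOp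

variable {n D : ℕ} {p q : Fin n} {o : CounterOp}

theorem source_toTransition : (o.toTransition p q : Transition n (D + 1)).source = p := by
  cases o <;> rfl

theorem rel_of_enabled (ho : o.Bounded D) {s : Config n (D + 1)}
    (h : (o.toTransition p q).Enabled s) :
    ∃ m', (o.toTransition p q).fire s = (q, m') ∧
      o.Rel (extendCounters s.2) (extendCounters m') := by
  cases o with
  | nop => exact ⟨_, rfl, by simp [Rel]⟩
  | inc i =>
    refine ⟨_, rfl, ?_⟩
    rw [tsub_zero, add_single_one, extendCounters_update _ ho, Rel, extendCounters_ofNat _ ho]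
  | dec i =>
    refine ⟨_, rfl, ?_, ?_⟩
    · rw [extendCounters_ofNat _ ho]
      exact (single_one_le_iff _ _).1 h.2
    · rw [add_zero, sub_single_one, extendCounters_update _ ho, extendCounters_ofNat _ ho]
  | test i =>
    refine ⟨_, rfl, ?_, ?_⟩
    · rw [extendCounters_ofNat _ ho]
      exact h.2
    · rw [add_zero]

theorem enabled_of_rel (ho : o.Bounded D) {m : Fin (D + 1) → ℕ} {M' : ℕ → ℕ}
    (h : o.Rel (extendCounters m) M') :
    (o.toTransition p q : Transition n (D + 1)).Enabled (p, m) := by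
  cases o with
  | nop => exact ⟨rfl, zero_le⟩
  | inc i => exact ⟨rfl, zero_le⟩
  | dec i => exact ⟨rfl, (single_one_le_iff _ _).2 (h.1.trans_eq (extendCounters_ofNat m ho))⟩
  | test i => exact ⟨rfl, (extendCounters_ofNat m ho).symm.trans h.1⟩

theorem Rel.functional {m m₁ m₂ : ℕ → ℕ} (h₁ : o.Rel m m₁) (h₂ : o.Rel m m₂) : m₁ = m₂ := by
  cases o with
  | nop => exact Eq.trans h₁ (Eq.symm h₂)
  | inc i => exact Eq.trans h₁ (Eq.symm h₂)
  | dec i => exact h₁.2.trans h₂.2.symm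
  | test i => exact h₁.2.trans h₂.2.symm

end CounterOp

/-! ### The biased random walk -/

/-- The transition of the random walk that increments counter `0`. -/
def walkUp {n D : ℕ} (w : Fin n) : Transition n (D + 1) := .pre w 0 (Pi.single 0 1) w

/-- The transition of the random walk that decrements counter `0`. -/
def walkDown {n D : ℕ} (w : Fin n) : Transition n (D + 1) := .pre w (Pi.single 0 1) 0 w

/-- The transition by which the random walk stops when counter `0` is zero. -/
def walkStop {n D : ℕ} (w a : Fin n) : Transition n (D + 1) := .zero w 0 0 a

open Classical in
/-- The machine that follows the control graph `E`, and from its exit `q` enters a random walk on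
counter `0`, in the control state `w`, that goes up with weight `2` and down with weight `1`;
at zero it may move to the dead end `a`. The control states of the graph are embedded by `e`. -/
noncomputable def walkPCM {Q : Type} {n : ℕ} (D : ℕ) (E : Finset (Q × CounterOp × Q)) (q : Q)
    (e : Q → Fin n) (w a : Fin n) : PCM n (D + 1) where
  Δ := E.image (fun x => x.2.1.toTransition (e x.1) (e x.2.2)) ∪
    {(CounterOp.inc 0).toTransition (e q) w, walkUp w, walkDown w, walkStop w a}
  W t _ := if t = walkUp w then 2 else 1
  W_pos t _ _ := by split_ifs <;> decide
  W_computable t _ := Computable.const _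

section Walk

variable {Q : Type} {n D : ℕ} {E : Finset (Q × CounterOp × Q)} {p q : Q} {e : Q → Fin n}
  {w a : Fin n}

theorem mem_walkPCM {t : Transition n (D + 1)} : t ∈ (walkPCM D E q e w a).Δ ↔
    (∃ x ∈ E, x.2.1.toTransition (e x.1) (e x.2.2) = t) ∨
      t = (CounterOp.inc 0).toTransition (e q) w ∨ t = walkUp w ∨ t = walkDown w ∨
        t = walkStop w a := by
  classical
  rw [walkPCM, Finset.mem_union, Finset.mem_image]
  simp only [Finset.mem_insert, Finset.mem_singleton]

theorem walkUp_ne_walkDown : (walkUp w : Transition n (D + 1)) ≠ walkDown w := by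
  intro h
  simp only [walkUp, walkDown, Transition.pre.injEq] at h
  have := congrFun h.2.1 0
  simp at this

/-- The target: the dead end with all counters zero. -/
def walkTarget (n D : ℕ) (a : Fin n) : Finset (Config n (D + 1)) := {(a, 0)}

/-- Completeness of the simulation: paths of the control graph are paths of positive probability. -/
theorem reach_of_graph (hb : ∀ x ∈ E, x.2.1.Bounded D) {m₀ : Fin (D + 1) → ℕ} {q' : Q}
    {M' : ℕ → ℕ}
    (h : Relation.ReflTransGen (GraphStep (E : Set (Q × CounterOp × Q)))
      (p, extendCounters m₀) (q', M')) :
    ∃ m', extendCounters m' = M' ∧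
      Relation.ReflTransGen (walkPCM D E q e w a).chain.Step (e p, m₀) (e q', m') := by
  have : ∀ s : Q × (ℕ → ℕ), Relation.ReflTransGen (GraphStep (E : Set (Q × CounterOp × Q)))
      (p, extendCounters m₀) s → ∃ m', extendCounters m' = s.2 ∧
      Relation.ReflTransGen (walkPCM D E q e w a).chain.Step (e p, m₀) (e s.1, m') := by
    intro s hs
    induction hs with
    | refl => exact ⟨m₀, rfl, .refl⟩
    | @tail b c _ hbc ih =>
      obtain ⟨m, hm, hr⟩ := ih
      obtain ⟨o, ho, hrel⟩ := hbc
      rw [← hm] at hrel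
      have hen := CounterOp.enabled_of_rel (p := e b.1) (q := e c.1) (hb _ ho) hrel
      obtain ⟨m', hm', hrel'⟩ := CounterOp.rel_of_enabled (hb _ ho) hen
      refine ⟨m', hrel'.functional hrel, hr.tail ?_⟩
      rw [← hm']
      exact PCM.step_fire _ (mem_walkPCM.2 (.inl ⟨_, ho, rfl⟩)) hen
  exact this _ h

/-- Soundness of the simulation: the dead end is reached only through the exit of the graph, since
until then the machine can fire only transitions that come from edges. -/
theorem exit_of_reach (he : Function.Injective e) (hw : ∀ x, e x ≠ w) (ha : ∀ x, e x ≠ a)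
    (hb : ∀ x ∈ E, x.2.1.Bounded D) {m₀ m' : Fin (D + 1) → ℕ}
    (h : Relation.ReflTransGen (walkPCM D E q e w a).chain.Step (e p, m₀) (a, m')) :
    ∃ M, Relation.ReflTransGen (GraphStep (E : Set (Q × CounterOp × Q)))
      (p, extendCounters m₀) (q, M) := by
  by_contra hno
  have inv : ∀ s, Relation.ReflTransGen (walkPCM D E q e w a).chain.Step (e p, m₀) s →
      ∃ x, s.1 = e x ∧ Relation.ReflTransGen (GraphStep (E : Set (Q × CounterOp × Q)))
        (p, extendCounters m₀) (x, extendCounters s.2) := by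
    intro s hs
    induction hs with
    | refl => exact ⟨p, rfl, .refl⟩
    | @tail b c _ hbc ih =>
      rcases PCM.step_cases _ hbc with ⟨t, ht, hen, hfire⟩ | rfl
      · obtain ⟨x, hx, hr⟩ := ih
        rcases mem_walkPCM.1 ht with ⟨⟨y, o, z⟩, hy, rfl⟩ | rfl | rfl | rfl | rfl
        · have hs := hen.source_eq
          rw [CounterOp.source_toTransition, hx] at hs
          obtain rfl := he hs
          obtain ⟨m', hm', hrel⟩ := CounterOp.rel_of_enabled (hb _ hy) hen
          rw [← hfire, hm']
          exact ⟨z, rfl, hr.tail ⟨o, hy, hrel⟩⟩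
        · have hs := hen.source_eq
          rw [CounterOp.source_toTransition, hx] at hs
          obtain rfl := he hs
          exact absurd ⟨_, hr⟩ hno
        all_goals exact absurd (hen.source_eq.trans hx).symm (hw x)
      · exact ih
  obtain ⟨x, hx, _⟩ := inv _ h
  exact ha x hx.symm

theorem canReach_of_walk (c : ℕ) :
    (walkPCM D E q e w a).chain.CanReach (w, Pi.single 0 c) (walkTarget n D a) := by
  refine ⟨(a, 0), by simp [walkTarget], ?_⟩
  induction c with
  | zero =>
    have h := PCM.step_fire (walkPCM D E q e w a) (s := (w, Pi.single 0 0)) (t := walkStop w a)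
      (mem_walkPCM.2 (by simp)) ⟨rfl, by simp⟩
    simp only [walkStop, Transition.fire, Pi.single_zero, add_zero] at h
    simpa using Relation.ReflTransGen.single h
  | succ c ih =>
    have h := PCM.step_fire (walkPCM D E q e w a) (s := (w, Pi.single 0 (c + 1)))
      (t := walkDown w) (mem_walkPCM.2 (by simp)) ⟨rfl, by
        rw [single_one_le_iff]; simp⟩
    simp only [walkDown, Transition.fire, sub_single_one, add_zero] at h
    refine ih.head ?_
    simpa [Pi.single] using h

open Classical in
/-- The harmonic function of the walk: from height `c` it hits zero with probability `2⁻ᶜ`. -/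
noncomputable def walkHarmonic (w : Fin n) (s : Config n (D + 1)) : ℝ≥0∞ :=
  if s.1 = w ∧ s.2 = Pi.single 0 (s.2 0) then 2⁻¹ ^ s.2 0 else 1

theorem walkHarmonic_walk (c : ℕ) :
    walkHarmonic w ((w, Pi.single 0 c) : Config n (D + 1)) = 2⁻¹ ^ c := by
  simp [walkHarmonic]

theorem walkHarmonic_le_one (s : Config n (D + 1)) : walkHarmonic w s ≤ 1 := by
  unfold walkHarmonic
  split_ifs
  · exact pow_le_one₀ zero_le (by simp)
  · exact le_rfl

open Classical in
theorem En_walk (hw : ∀ x, e x ≠ w) (c : ℕ) :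
    (walkPCM D E q e w a).En (w, Pi.single 0 (c + 1)) =
      ({walkUp w, walkDown w} : Finset (Transition n (D + 1))) := by
  ext t
  rw [PCM.mem_En, mem_walkPCM, Finset.mem_insert, Finset.mem_singleton]
  constructor
  · rintro ⟨ht, hen⟩
    rcases ht with ⟨y, hy, rfl⟩ | rfl | rfl | rfl | rfl
    · have hs := hen.source_eq
      rw [CounterOp.source_toTransition] at hs
      exact absurd hs (hw _)
    · have hs := hen.source_eq
      rw [CounterOp.source_toTransition] at hs
      exact absurd hs (hw _)
    · exact .inl rfl
    · exact .inr rfl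
    · have := hen.2
      simp at this
  · rintro (rfl | rfl)
    · exact ⟨by simp, rfl, zero_le⟩
    · exact ⟨by simp, rfl, (single_one_le_iff _ _).2 (by simp)⟩

theorem expect_walkHarmonic (hw : ∀ x, e x ≠ w) (c : ℕ) :
    (walkPCM D E q e w a).chain.expect (walkHarmonic w) (w, Pi.single 0 (c + 1)) =
      2⁻¹ ^ (c + 1) := by
  classical
  have hup : (walkUp w : Transition n (D + 1)).fire (w, Pi.single 0 (c + 1)) =
      (w, Pi.single 0 (c + 2)) := by
    simp only [walkUp, Transition.fire, tsub_zero, ← Pi.single_add]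
  have hdown : (walkDown w : Transition n (D + 1)).fire (w, Pi.single 0 (c + 1)) =
      (w, Pi.single 0 c) := by
    simp only [walkDown, Transition.fire, add_zero, sub_single_one, Pi.single_eq_same]
    simp [Pi.single]
  have hne : ((walkPCM D E q e w a).En (w, Pi.single 0 (c + 1))).Nonempty := by
    rw [En_walk hw]
    exact Finset.insert_nonempty _ _
  rw [PCM.expect_chain _ _ hne, PCM.weight,
    En_walk hw, Finset.sum_pair walkUp_ne_walkDown, Finset.sum_pair walkUp_ne_walkDown, hup,
    hdown, walkHarmonic_walk, walkHarmonic_walk]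
  simp only [walkPCM, if_neg walkUp_ne_walkDown.symm, if_true]
  have h2 : (2 : ℝ≥0∞) * 2⁻¹ = 1 := ENNReal.mul_inv_cancel (by simp) (by simp)
  have h3 : (3 : ℝ≥0∞)⁻¹ * 3 = 1 := ENNReal.inv_mul_cancel (by simp) (by simp)
  have e1 : (2 : ℝ≥0∞) * 2⁻¹ ^ (c + 2) = 2⁻¹ ^ (c + 1) := by
    rw [pow_succ', ← mul_assoc, h2, one_mul]
  have e2 : (2⁻¹ : ℝ≥0∞) ^ c = 2 * 2⁻¹ ^ (c + 1) := by
    rw [pow_succ', ← mul_assoc, h2, one_mul]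
  push_cast
  rw [e1, one_mul, e2]
  calc (3 : ℝ≥0∞)⁻¹ * (2⁻¹ ^ (c + 1) + 2 * 2⁻¹ ^ (c + 1)) = 3⁻¹ * 3 * 2⁻¹ ^ (c + 1) := by ring
    _ = _ := by rw [h3, one_mul]

theorem isCertificate_walkHarmonic (hw : ∀ x, e x ≠ w) (hwa : w ≠ a) :
    (walkPCM D E q e w a).chain.IsCertificate (walkTarget n D a) (w, Pi.single 0 1)
      (walkHarmonic w) where
  expect_le t _ := by
    by_cases ht : t.1 = w ∧ t.2 = Pi.single 0 (t.2 0)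
    · obtain ⟨x, m⟩ := t
      obtain ⟨rfl, hm⟩ := ht
      simp only at hm
      rw [hm]
      cases m 0 with
      | zero =>
        rw [walkHarmonic_walk, pow_zero]
        exact MarkovChain.expect_le_one walkHarmonic_le_one _
      | succ c => rw [walkHarmonic_walk, expect_walkHarmonic hw]
    · rw [walkHarmonic, if_neg ht]
      exact MarkovChain.expect_le_one walkHarmonic_le_one _
  eq_one t ht := by
    refine if_neg ?_
    rintro ⟨h1, h2⟩
    rcases ht with ht | ht
    · have : t = (a, 0) := by simpa [walkTarget] using ht
      exact hwa (by rw [← h1, this])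
    · have : t = (w, Pi.single 0 (t.2 0)) := Prod.ext h1 h2
      exact ht (this ▸ canReach_of_walk _)
  le_one := walkHarmonic_le_one
  lt_one := by
    rw [walkHarmonic_walk, pow_one]
    exact ENNReal.inv_lt_one.2 (by norm_num)

/-- The machine is decisive exactly when its control graph does not reach the exit, provided that
the graph leaves all counters zero at the exit. -/
theorem isDecisive_walkPCM_iff (he : Function.Injective e) (hw : ∀ x, e x ≠ w)
    (ha : ∀ x, e x ≠ a) (hwa : w ≠ a) (hb : ∀ x ∈ E, x.2.1.Bounded D) {m₀ : Fin (D + 1) → ℕ}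
    (hclean : ∀ M, Relation.ReflTransGen (GraphStep (E : Set (Q × CounterOp × Q)))
      (p, extendCounters m₀) (q, M) → M = 0) :
    (walkPCM D E q e w a).chain.IsDecisive (e p, m₀) (walkTarget n D a) ↔
      ¬ ∃ M, Relation.ReflTransGen (GraphStep (E : Set (Q × CounterOp × Q)))
        (p, extendCounters m₀) (q, M) := by
  constructor
  · rintro hdec ⟨M, hM⟩
    obtain rfl := hclean M hM
    obtain ⟨m', hm', hr⟩ := reach_of_graph (q := q) (e := e) (w := w) (a := a) hb hM
    rw [← extendCounters_zero (d := D + 1)] at hm'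
    obtain rfl := extendCounters_injective hm'
    have hstep := PCM.step_fire (walkPCM D E q e w a) (s := (e q, 0))
      (t := (CounterOp.inc 0).toTransition (e q) w) (mem_walkPCM.2 (.inr (.inl rfl)))
      ⟨rfl, zero_le⟩
    have hfire : ((CounterOp.inc 0).toTransition (e q) w).fire
        ((e q, 0) : Config n (D + 1)) = (w, Pi.single 0 1) := by
      simp [CounterOp.toTransition, Transition.fire]
    rw [hfire] at hstep
    refine MarkovChain.not_isDecisive_of_reach ?_ (isCertificate_walkHarmonic hw hwa)
      (hr.tail hstep) hdec
    intro s hs s' hss'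
    have hs0 : s = (a, 0) := by simpa [walkTarget] using hs
    rcases PCM.step_cases _ hss' with ⟨t, ht, hen, _⟩ | rfl
    · have hsrc := hen.source_eq
      rw [hs0] at hsrc
      rcases mem_walkPCM.1 ht with ⟨y, hy, rfl⟩ | rfl | rfl | rfl | rfl
      · rw [CounterOp.source_toTransition] at hsrc
        exact absurd hsrc (ha _)
      · rw [CounterOp.source_toTransition] at hsrc
        exact absurd hsrc (ha _)
      all_goals exact absurd hsrc hwa
    · exact hs
  · intro hno
    refine MarkovChain.isDecisive_of_not_canReach ?_
    rintro ⟨s, hs, hr⟩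
    have hs0 : s = (a, 0) := by simpa [walkTarget] using hs
    subst hs0
    exact hno (exit_of_reach he hw ha hb hr)

end Walk

/-! ### Undecidability -/

/-- A single static machine with a fixed target whose decisiveness, as a function of the initial
value of one counter, is the complement of a given recursively enumerable predicate. -/
theorem exists_static_pcm {f : ℕ → ℕ → ℕ} (hf : Primrec₂ f) :
    ∃ (n D : ℕ) (C : PCM n (D + 1)) (v : Transition n (D + 1) → ℕ) (q₀ : Fin n)
      (A : Finset (Config n (D + 1))), (∀ t m, C.W t m = v t) ∧
      ∀ x, C.chain.IsDecisive (q₀, Pi.single 0 x) (A : Set (Config n (D + 1))) ↔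
        ¬ ∃ k, f k x = 0 := by
  classical
  obtain ⟨R, hR, hRs⟩ := exists_counterProg_of_primrec hf
  obtain ⟨Q, _, E, p, q, hE, hG⟩ := hR.exists_graph
  obtain ⟨D, hD⟩ := CounterOp.exists_bounded hE
  obtain ⟨n, ⟨e⟩⟩ := Finite.exists_equiv_fin (Q ⊕ Bool)
  refine ⟨n, D, walkPCM D hE.toFinset q (e ∘ Sum.inl) (e (.inr false)) (e (.inr true)),
    fun t => if t = walkUp (e (.inr false)) then 2 else 1, e (.inl p),
    walkTarget n D (e (.inr true)), fun _ _ => rfl, fun x => ?_⟩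
  have h := isDecisive_walkPCM_iff (E := hE.toFinset) (p := p) (q := q) (D := D)
    (e := e ∘ Sum.inl) (w := e (.inr false)) (a := e (.inr true)) (m₀ := Pi.single 0 x)
    (e.injective.comp Sum.inl_injective) (by simp) (by simp) (by simp)
    (by simpa using hD) (by
      intro M hM
      rw [extendCounters_single, hE.coe_toFinset, hG, hRs] at hM
      exact hM.1)
  rw [extendCounters_single, hE.coe_toFinset] at h
  simp only [hG, hRs] at h
  rw [Function.comp_apply] at h
  rw [h]
  simp

/-- Decisiveness of static machines is undecidable for every way of describing weights that has
descriptions of the constants. -/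
theorem not_computable_isDecisive {ω : Type} [Primcodable ω]
    (R : ∀ d : ℕ, ω → ((Fin d → ℕ) → ℕ) → Prop) (const : ℕ → ω)
    (hconst : ∀ d w (g : (Fin d → ℕ) → ℕ), (∀ m, g m = w) → R d (const w) g) :
    ¬ ∃ f : InputCode ω → Bool, Computable f ∧
      ∀ (n d : ℕ) (C : PCM n d) (s₀ : Config n d) (A : Finset (Config n d)) (c : InputCode ω),
        C.IsStatic → Describes (R d) c C s₀ A →
          (f c = true ↔ C.chain.IsDecisive s₀ (A : Set (Config n d))) := by
  rintro ⟨F, hF, hspec⟩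
  let f : ℕ → ℕ → ℕ := fun k x =>
    ((Nat.Partrec.Code.evaln k (Denumerable.ofNat Nat.Partrec.Code x) 0).map fun _ => 0).getD 1
  have hf : Primrec₂ f := by
    refine Primrec.option_getD.comp (Primrec.option_map (Nat.Partrec.Code.primrec_evaln.comp
      ((Primrec.fst.pair ((Primrec.ofNat _).comp Primrec.snd)).pair (Primrec.const 0)))
      (Primrec.const 0).to₂) (Primrec.const 1)
  have hhalt : ∀ x, (∃ k, f k x = 0) ↔
      ((Denumerable.ofNat Nat.Partrec.Code x).eval 0).Dom := by
    intro x
    rw [Part.dom_iff_mem]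
    constructor
    · rintro ⟨k, hk⟩
      cases h : Nat.Partrec.Code.evaln k (Denumerable.ofNat Nat.Partrec.Code x) 0 with
      | none => simp [f, h] at hk
      | some y => exact ⟨y, Nat.Partrec.Code.evaln_complete.2 ⟨k, h⟩⟩
    · rintro ⟨y, hy⟩
      obtain ⟨k, hk⟩ := Nat.Partrec.Code.evaln_complete.1 hy
      have hk' : Nat.Partrec.Code.evaln k (Denumerable.ofNat Nat.Partrec.Code x) 0 = some y := hk
      exact ⟨k, by simp [f, hk']⟩
  obtain ⟨n, D, C, v, q₀, A, hv, hdec⟩ := exists_static_pcm hf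
  let l : List (Transition n (D + 1) × ω) := C.Δ.toList.map fun t => (t, const (v t))
  -- Only the initial value of counter `0` depends on the instance of the halting problem.
  let c : Nat.Partrec.Code → InputCode ω := fun e =>
    (n, D + 1, l.map (fun tx => (tx.1.code, tx.2)),
      (q₀.val, List.ofFn fun i : Fin (D + 1) => if i = 0 then Encodable.encode e else 0),
      A.toList.map Config.code)
  have hc : Computable c := by
    have hl : Primrec fun e : Nat.Partrec.Code =>
        List.ofFn fun i : Fin (D + 1) => if i = 0 then Encodable.encode e else 0 := by
      refine Primrec.list_ofFn fun i => ?_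
      by_cases h : i = 0
      · simpa [h] using Primrec.encode
      · simpa [h] using Primrec.const 0
    exact ((Primrec.const n).pair ((Primrec.const (D + 1)).pair ((Primrec.const _).pair
      (((Primrec.const q₀.val).pair hl).pair (Primrec.const _))))).to_comp
  refine ComputablePred.halting_problem 0 (ComputablePred.computable_iff.2
    ⟨fun e => !(F (c e)), Primrec.not.to_comp.comp (hF.comp hc), ?_⟩)
  funext e
  have hs := hspec n (D + 1) C (q₀, Pi.single 0 (Encodable.encode e)) A (c e)
    (fun t _ => ⟨v t, hv t⟩) ⟨l, A.toList, ?_, ?_, ?_, ?_⟩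
  · rw [hdec, hhalt, Denumerable.ofNat_encode] at hs
    rw [eq_iff_iff]
    cases hFe : F (c e) <;> simp [hFe] at hs ⊢ <;> exact hs
  · intro t
    simp [l]
  · intro t x htx
    simp only [l, List.mem_map, Finset.mem_toList, Prod.mk.injEq] at htx
    obtain ⟨t, _, rfl, rfl⟩ := htx
    exact hconst _ _ _ (hv t)
  · simp
  · simp only [c, Config.code, Prod.mk.injEq, true_and, and_true]
    congr 1
    funext i
    simp [Pi.single_apply]

/-- Decisiveness w.r.t. an initial configuration and a finite target set is undecidable
for static probabilistic counter machines, and for probabilistic counter machines with weights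
given by programs. -/
theorem mainTheorem2 :
    (¬ ∃ f : InputCode ℕ → Bool, Computable f ∧
      ∀ (n d : ℕ) (C : PCM n d) (s₀ : Config n d) (A : Finset (Config n d)) (c : InputCode ℕ),
        C.IsStatic → Describes ConstWeight c C s₀ A →
          (f c = true ↔ C.chain.IsDecisive s₀ (A : Set (Config n d)))) ∧
    (¬ ∃ f : InputCode Nat.Partrec.Code → Bool, Computable f ∧
      ∀ (n d : ℕ) (C : PCM n d) (s₀ : Config n d) (A : Finset (Config n d))
        (c : InputCode Nat.Partrec.Code),
        Describes ProgramWeight c C s₀ A →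
          (f c = true ↔ C.chain.IsDecisive s₀ (A : Set (Config n d)))) := by
  refine ⟨not_computable_isDecisive (fun _ => ConstWeight) id fun _ _ _ h => h, ?_⟩
  rintro ⟨f, hf, h⟩
  refine not_computable_isDecisive (fun _ => ProgramWeight) Nat.Partrec.Code.const ?_
    ⟨f, hf, fun n d C s₀ A c _ => h n d C s₀ A c⟩
  intro d w g hg m
  rw [Nat.Partrec.Code.eval_const, hg]
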